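/- Let $\mathcal A$ and $\mathcal B$ be abelian categories and let $(\Phi,\Psi)$ be a right adjoint pair of contravariant additive functors $\Phi:\mathcal A\to\mathcal B$, $\Psi:\mathcal B\to\mathcal A$, i.e. there is a natural bijection $\operatorname{Hom}_{\mathcal A}(X,\Psi Y)\cong\operatorname{Hom}_{\mathcal B}(Y,\Phi X)$; let $\eta_X:X\to\Psi\Phi X$ be its unit on $\mathcal A$. Let each of $*$ and $\dagger$ be one of the four boundedness types (unbounded, $+$, $-$, $b$), and let $\mathcal P\subseteq\mathcal K^*(\mathcal A)$ and $\mathcal Q\subseteq\mathcal K^\dagger(\mathcal B)$ be triangulated subcategories of the homotopy categories such that every complex $X$ in $\mathcal K^*(\mathcal A)$ (resp. $Y$ in $\mathcal K^\dagger(\mathcal B)$) admits a quasi-isomorphism $P\to X$ with $P\in\mathcal P$ (resp. $Q\to Y$ with $Q\in\mathcal Q$), and such that $\Phi$ (resp. $\Psi$), applied term by term, sends exact complexes in $\mathcal P$ (resp. $\mathcal Q$) to exact complexes. Then the right derived functors $\mathbf R^*\Phi:\mathcal D^*(\mathcal A)\to\mathcal D(\mathcal B)$ and $\mathbf R^\dagger\Psi:\mathcal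 D^\dagger(\mathcal B)\to\mathcal D(\mathcal A)$ exist and are computed by $\mathbf R^*\Phi X=\Phi P$ and $\mathbf R^\dagger\Psi Y=\Psi Q$ for quasi-isomorphisms $P\to X$, $Q\to Y$ with $P\in\mathcal P$, $Q\in\mathcal Q$. An object $X$ of $\mathcal A$, regarded as a complex concentrated in degree $0$, is called $\Phi$-acyclic if $H^i(\mathbf R^*\Phi X)=0$ for all $i\neq 0$; $\Psi$-acyclic objects of $\mathcal B$ are defined in the same way. The object $X$ is called $\mathcal D$-reflexive if $\mathbf R^*\Phi X$ lies in the domain $\mathcal D^\dagger(\mathcal B)$ of $\mathbf R^\dagger\Psi$ and the derived unit $\hat\eta_X:X\to\mathbf R^\dagger\Psi(\mathbf R^*\Phi X)$ is an isomorphism in the derived category of $\mathcal A$. Explicitly, this means that for some quasi-isomorphisms $P\to X$ with $P\in\mathcal P$ and $q:Q\to\Phi P$ with $Q\in\mathcal Q$, the morphism $\hat\eta_X$ given by the inverse of $P\to X$ followed by $P\xrightarrow{\eta_P}\Psi\Phi P\xrightarrow{\Psi q}\Psi Q$ is an isomorphism in the derived category. Finally, $X$ belongs to the class $\mathcal G_{\Phi\Psi}$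 if $X$ is $\Phi$-acyclic, $\Phi X$ is $\Psi$-acyclic, and $\eta_X:X\to\Psi\Phi X$ is an isomorphism. Then: if an object $X$ of $\mathcal A$ is $\Phi$-acyclic and $\mathcal D$-reflexive, $X$ belongs to $\mathcal G_{\Phi\Psi}$. -/

import Mathlib

open CategoryTheory Limits Opposite

universe w₁ w₂ v₁ v₂ u₁ u₂

/-- The four types of homotopy and derived categories: unbounded, bounded below (`+`),
bounded above (`-`) and bounded (`b`). -/
inductive BoundType
  | unbounded
  | plus
  | minus
  | bounded

section Complexes

variable {A : Type u₁} [Category.{v₁} A] [Abelian A]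
  {B : Type u₂} [Category.{v₂} B] [Abelian B]

/-- The cochain complexes which are the objects of `K(A)`, `K⁺(A)` (bounded below),
`K⁻(A)` (bounded above), `Kᵇ(A)` (bounded), respectively. -/
def BoundType.Holds (b : BoundType) (X : CochainComplex A ℤ) : Prop :=
  match b with
  | .unbounded => True
  | .plus => ∃ n : ℤ, X.IsStrictlyGE n
  | .minus => ∃ n : ℤ, X.IsStrictlyLE n
  | .bounded => (∃ n : ℤ, X.IsStrictlyGE n) ∧ ∃ n : ℤ, X.IsStrictlyLE n

/-- The stalk complex of an object, concentrated in degree `0`. -/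
noncomputable abbrev stalk (X : A) : CochainComplex A ℤ :=
  (HomologicalComplex.single A (ComplexShape.up ℤ) 0).obj X

/-- The term-by-term extension of a contravariant additive functor `Φ` from `A` to `B` to a
contravariant functor between cochain complexes: `(Φ X)ⁿ = Φ (X⁻ⁿ)`. -/
noncomputable def contraMap (Φ : Aᵒᵖ ⥤ B) [Φ.Additive] :
    (CochainComplex A ℤ)ᵒᵖ ⥤ CochainComplex B ℤ :=
  (CochainComplex.opEquivalence A).functor ⋙ Φ.mapHomologicalComplex (ComplexShape.up ℤ)

/-- The complex `Φ X`. -/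
noncomputable abbrev contraObj (Φ : Aᵒᵖ ⥤ B) [Φ.Additive] (X : CochainComplex A ℤ) :
    CochainComplex B ℤ :=
  (contraMap Φ).obj (op X)

/-- The term-by-term extension to complexes of the unit `η : X ⟶ ΨΦX` of a right adjoint pair
`(Φ, Ψ)` of contravariant functors. The right adjointness, that is, a natural bijection
`Hom_A(X, Ψ Y) ≃ Hom_B(Y, Φ X)`, is expressed as an adjunction between the covariant functors
`Φ.rightOp : A ⥤ Bᵒᵖ` and `Ψ : Bᵒᵖ ⥤ A`. -/
noncomputable def complexUnit {Φ : Aᵒᵖ ⥤ B} {Ψ : Bᵒᵖ ⥤ A} [Φ.Additive] [Ψ.Additive]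
    (adj : Φ.rightOp ⊣ Ψ) (X : CochainComplex A ℤ) :
    X ⟶ contraObj Ψ (contraObj Φ X) where
  f n := (X.XIsoOfEq (neg_neg n).symm).hom ≫ adj.unit.app (X.X (- -n))
  comm' i j _ := by
    have h : X.d (- -i) (- -j) ≫ adj.unit.app (X.X (- -j)) =
      adj.unit.app (X.X (- -i)) ≫ (contraObj Ψ (contraObj Φ X)).d i j :=
        adj.unit.naturality (X.d (- -i) (- -j))
    have h' : (X.XIsoOfEq (neg_neg i).symm).hom ≫ X.d (- -i) (- -j) =
      X.d i j ≫ (X.XIsoOfEq (neg_neg j).symm).hom := by simp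
    refine (Category.assoc _ _ _).trans ?_
    refine (congrArg (fun t => (X.XIsoOfEq (neg_neg i).symm).hom ≫ t) h.symm).trans ?_
    refine (Category.assoc _ _ _).symm.trans ?_
    refine (congrArg (fun t => t ≫ adj.unit.app (X.X (- -j))) h').trans ?_
    exact Category.assoc _ _ _

/-- The condition under which the right derived functor of the contravariant functor `Φ` exists on
the derived category of type `b`: `𝓟` is a triangulated subcategory of the homotopy category
of type `b`, every complex of type `b` receives a quasi-isomorphism from a complex in `𝓟`, and
`Φ` sends exact complexes in `𝓟` to exact complexes. -/
structure IsAdapted (b : BoundType) (Φ : Aᵒᵖ ⥤ B) [Φ.Additive]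
    (𝓟 : ObjectProperty (HomotopyCategory A (ComplexShape.up ℤ))) : Prop where
  isTriangulated : 𝓟.IsTriangulated
  holds (P : CochainComplex A ℤ) (hP : 𝓟 ((HomotopyCategory.quotient A _).obj P)) : b.Holds P
  exists_quasiIso (X : CochainComplex A ℤ) (hX : b.Holds X) :
    ∃ (P : CochainComplex A ℤ) (p : P ⟶ X),
      𝓟 ((HomotopyCategory.quotient A _).obj P) ∧ QuasiIso p
  acyclic (P : CochainComplex A ℤ) (hP : 𝓟 ((HomotopyCategory.quotient A _).obj P))
    (hP' : P.Acyclic) : (contraObj Φ P).Acyclic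

/-- A complex `P` in `𝓟` together with a quasi-isomorphism `P ⟶ X`. -/
structure PResolution (𝓟 : ObjectProperty (HomotopyCategory A (ComplexShape.up ℤ)))
    (X : CochainComplex A ℤ) where
  P : CochainComplex A ℤ
  mem : 𝓟 ((HomotopyCategory.quotient A _).obj P)
  p : P ⟶ X
  quasiIso : QuasiIso p

attribute [instance] PResolution.quasiIso

/-- The value `𝐑Φ X = Φ P` of the derived functor of `Φ` at a complex `X`, as an object of the
derived category of `B`, computed by a quasi-isomorphism `P ⟶ X` with `P` in `𝓟`. If `𝓟` is
adapted to `Φ`, it does not depend on this choice, up to isomorphism. -/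
noncomputable def PResolution.derivedObj
    {𝓟 : ObjectProperty (HomotopyCategory A (ComplexShape.up ℤ))} {X : CochainComplex A ℤ}
    (R : PResolution 𝓟 X) (Φ : Aᵒᵖ ⥤ B) [Φ.Additive] [HasDerivedCategory.{w₂} B] :
    DerivedCategory B :=
  DerivedCategory.Q.obj (contraObj Φ R.P)

/-- `X` is `Φ`-acyclic: `Hⁱ(𝐑Φ X) = 0` for all `i ≠ 0`. -/
def IsContraAcyclic (𝓟 : ObjectProperty (HomotopyCategory A (ComplexShape.up ℤ)))
    (Φ : Aᵒᵖ ⥤ B) [Φ.Additive] [HasDerivedCategory.{w₂} B] (X : A) : Prop :=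
  ∀ (R : PResolution 𝓟 (stalk X)) (i : ℤ), i ≠ 0 →
    IsZero ((DerivedCategory.homologyFunctor B i).obj (R.derivedObj Φ))

variable {Φ : Aᵒᵖ ⥤ B} {Ψ : Bᵒᵖ ⥤ A} [Φ.Additive] [Ψ.Additive]

/-- The unit `X ⟶ 𝐑Ψ (𝐑Φ X)` of the derived adjunction, a morphism of the derived category of `A`.
Here `𝐑Φ X = Φ P` for a quasi-isomorphism `P ⟶ X` with `P` in `𝓟`, and `𝐑Ψ (Φ P) = Ψ Q` for a
quasi-isomorphism `q : Q ⟶ Φ P` with `Q` in `𝓠`; the unit is the inverse of `P ⟶ X`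
followed by the composition of `η : P ⟶ ΨΦP` and `Ψ q : ΨΦP ⟶ ΨQ`. -/
noncomputable def derivedUnit (adj : Φ.rightOp ⊣ Ψ) [HasDerivedCategory.{w₁} A]
    {𝓟 : ObjectProperty (HomotopyCategory A (ComplexShape.up ℤ))}
    {𝓠 : ObjectProperty (HomotopyCategory B (ComplexShape.up ℤ))}
    {X : CochainComplex A ℤ} (R : PResolution 𝓟 X) (S : PResolution 𝓠 (contraObj Φ R.P)) :
    DerivedCategory.Q.obj X ⟶ S.derivedObj Ψ :=
  inv (DerivedCategory.Q.map R.p) ≫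
    DerivedCategory.Q.map (complexUnit adj R.P ≫ (contraMap Ψ).map S.p.op)

/-- The object `X` is `𝒟`-reflexive: the unit of the derived adjunction at its stalk complex is
an isomorphism. This includes that `𝐑Φ X` lies in the derived category on which `𝐑Ψ` is
defined, that is, that for some choice of `P` there is a quasi-isomorphism from a complex
in `𝓠` to `Φ P`. -/
def IsDReflexive (adj : Φ.rightOp ⊣ Ψ) [HasDerivedCategory.{w₁} A]
    (𝓟 : ObjectProperty (HomotopyCategory A (ComplexShape.up ℤ)))
    (𝓠 : ObjectProperty (HomotopyCategory B (ComplexShape.up ℤ))) (X : A) : Prop :=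
  ∃ (R : PResolution 𝓟 (stalk X)) (S : PResolution 𝓠 (contraObj Φ R.P)),
    IsIso (derivedUnit adj R S)

/-- The class `𝒢_{ΦΨ}`: `X` is `Φ`-acyclic, `Φ X` is `Ψ`-acyclic, and `η : X ⟶ ΨΦX` is an
isomorphism. -/
structure IsInG (adj : Φ.rightOp ⊣ Ψ) [HasDerivedCategory.{w₁} A] [HasDerivedCategory.{w₂} B]
    (𝓟 : ObjectProperty (HomotopyCategory A (ComplexShape.up ℤ)))
    (𝓠 : ObjectProperty (HomotopyCategory B (ComplexShape.up ℤ))) (X : A) : Prop where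
  acyclic : IsContraAcyclic.{w₂} 𝓟 Φ X
  acyclic' : IsContraAcyclic.{w₁} 𝓠 Ψ (Φ.obj (op X))
  isIso_unit : IsIso (adj.unit.app X)

end Complexes

/-! ### Contravariant functors on complexes, and quasi-isomorphisms between adapted complexes. -/

section ContravariantExtension

variable {A : Type u₁} [Category.{v₁} A] [Abelian A]
  {B : Type u₂} [Category.{v₂} B] [Abelian B]

/-! By adjointness `Φ` and `Ψ` are left exact, so `H⁰(𝐑Φ X) = Φ X` and likewise for `Ψ`
(`IsAdapted.quasiIsoAt_zero_p`). If `X` is `Φ`-acyclic, then `𝐑Φ X` is the stalk `Φ X`, and the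
derived unit becomes `X ⟶ ΨΦX ⟶ ΨQ'` for a resolution `Q' ⟶ Φ X` in `𝓠` (`quasiIso_stalk_unit`).
When this is a quasi-isomorphism, `ΨQ'` has cohomology in degree `0` only, so `Φ X` is `Ψ`-acyclic;
and since `ΨΦX ⟶ ΨQ'` is an isomorphism on `H⁰`, so is `η_X`.

The delicate point is comparing the given `Q ⟶ Φ P` with `Q' ⟶ Φ X`. A homotopy pullback over `Φ P`
could leave the allowed boundedness type. Truncating `P` and `Q` in degrees `≤ 0` instead yields a
degreewise epimorphism onto the stalk `Φ X`, along which a strict pullback can be taken. -/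

lemma contraObj_d (Φ : Aᵒᵖ ⥤ B) [Φ.Additive] (K : CochainComplex A ℤ) (i j : ℤ) :
    (contraObj Φ K).d i j = Φ.map (K.d (-j) (-i)).op := rfl

lemma contraMap_map_comp (Φ : Aᵒᵖ ⥤ B) [Φ.Additive] {K L M : CochainComplex A ℤ}
    (f : K ⟶ L) (g : L ⟶ M) :
    (contraMap Φ).map (f ≫ g).op = (contraMap Φ).map g.op ≫ (contraMap Φ).map f.op := by
  rw [op_comp, Functor.map_comp]

/-- The image of a short complex of cochain complexes under a contravariant functor. -/
noncomputable def contraShortComplex (Φ : Aᵒᵖ ⥤ B) [Φ.Additive]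
    (S : ShortComplex (CochainComplex A ℤ)) : ShortComplex (CochainComplex B ℤ) :=
  ShortComplex.mk ((contraMap Φ).map S.g.op) ((contraMap Φ).map S.f.op) (by
    rw [← contraMap_map_comp, S.zero]
    ext n
    exact Φ.map_zero _ _)

lemma contraShortComplex_shortExact (Φ : Aᵒᵖ ⥤ B) [Φ.Additive]
    (S : ShortComplex (CochainComplex A ℤ))
    (σ : ∀ n, (S.map (HomologicalComplex.eval A _ n)).Splitting) :
    (contraShortComplex Φ S).ShortExact :=
  HomologicalComplex.shortExact_of_degreewise_shortExact _
    (fun n => ((σ (-n)).op.map Φ).shortExact)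

/-- The image of a morphism of short complexes under a contravariant functor. -/
noncomputable def contraShortComplexMap (Φ : Aᵒᵖ ⥤ B) [Φ.Additive]
    {S T : ShortComplex (CochainComplex A ℤ)} (f : S ⟶ T) :
    contraShortComplex Φ T ⟶ contraShortComplex Φ S where
  τ₁ := (contraMap Φ).map f.τ₃.op
  τ₂ := (contraMap Φ).map f.τ₂.op
  τ₃ := (contraMap Φ).map f.τ₁.op
  comm₁₂ := by
    dsimp [contraShortComplex]
    rw [← contraMap_map_comp, ← contraMap_map_comp, f.comm₂₃]
  comm₂₃ := by
    dsimp [contraShortComplex]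
    rw [← contraMap_map_comp, ← contraMap_map_comp, f.comm₁₂]

lemma contraObj_acyclic_of_homotopyEquiv (Φ : Aᵒᵖ ⥤ B) [Φ.Additive] {K L : CochainComplex A ℤ}
    (e : HomotopyEquiv K L) (hL : (contraObj Φ L).Acyclic) : (contraObj Φ K).Acyclic := by
  let e' : HomotopyEquiv (contraObj Φ L) (contraObj Φ K) :=
    { hom := (contraMap Φ).map e.hom.op
      inv := (contraMap Φ).map e.inv.op
      homotopyHomInvId :=
        (Homotopy.ofEq (by rw [← contraMap_map_comp]; rfl)).trans
          ((Φ.mapHomotopy (CochainComplex.homotopyOp e.homotopyInvHomId)).trans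
            (Homotopy.ofEq ((contraMap Φ).map_id _)))
      homotopyInvHomId :=
        (Homotopy.ofEq (by rw [← contraMap_map_comp]; rfl)).trans
          ((Φ.mapHomotopy (CochainComplex.homotopyOp e.homotopyHomInvId)).trans
            (Homotopy.ofEq ((contraMap Φ).map_id _))) }
  have he' : QuasiIso e'.hom := HomotopyEquiv.quasiIso_hom e'
  exact fun n => (quasiIsoAt_iff_exactAt e'.hom n (hL n)).1 (he'.quasiIsoAt n)

variable {b : BoundType} {Φ : Aᵒᵖ ⥤ B} [Φ.Additive]
  {𝓟 : ObjectProperty (HomotopyCategory A (ComplexShape.up ℤ))}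

/-- `𝓟` need not be closed under isomorphism, so cones of maps in `𝓟` are only known to lie in its
isomorphism closure. -/
lemma IsAdapted.acyclic_of_isoClosure (h : IsAdapted b Φ 𝓟) (K : CochainComplex A ℤ)
    (hK : 𝓟.isoClosure ((HomotopyCategory.quotient A _).obj K)) (hK' : K.Acyclic) :
    (contraObj Φ K).Acyclic := by
  obtain ⟨L, hL, ⟨e⟩⟩ := hK
  obtain ⟨L, rfl⟩ := HomotopyCategory.quotient_obj_surjective L
  let e' : HomotopyEquiv K L := HomotopyCategory.homotopyEquivOfIso e
  have he' : QuasiIso e'.hom := HomotopyEquiv.quasiIso_hom e'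
  exact contraObj_acyclic_of_homotopyEquiv Φ e' (h.acyclic L hL
    (fun n => (quasiIsoAt_iff_exactAt e'.hom n (hK' n)).1 (he'.quasiIsoAt n)))

lemma acyclic_mappingCone {K L : CochainComplex A ℤ} (f : K ⟶ L) [hf : QuasiIso f] :
    (CochainComplex.mappingCone f).Acyclic := by
  rw [← HomotopyCategory.quotient_obj_mem_subcategoryAcyclic_iff_acyclic]
  rw [← HomologicalComplex.mem_quasiIso_iff, ← HomotopyCategory.quotient_map_mem_quasiIso_iff,
    HomotopyCategory.quasiIso_eq_trW_subcategoryAcyclic] at hf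
  exact ((HomotopyCategory.subcategoryAcyclic A).trW_iff_of_distinguished _
      (HomotopyCategory.mappingCone_triangleh_distinguished f)).1 hf

lemma IsAdapted.acyclic_mappingCone (h : IsAdapted b Φ 𝓟) {K L : CochainComplex A ℤ}
    (hK : 𝓟 ((HomotopyCategory.quotient A _).obj K))
    (hL : 𝓟 ((HomotopyCategory.quotient A _).obj L)) (f : K ⟶ L) [QuasiIso f] :
    (contraObj Φ (CochainComplex.mappingCone f)).Acyclic := by
  have := h.isTriangulated
  exact h.acyclic_of_isoClosure _
    (𝓟.ext_of_isTriangulatedClosed₃' _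
      (HomotopyCategory.mappingCone_triangleh_distinguished f) hK hL) (_root_.acyclic_mappingCone f)

open CochainComplex in
/-- An adapted contravariant functor preserves quasi-isomorphisms between objects of the
adapted subcategory. -/
lemma IsAdapted.quasiIso_map (h : IsAdapted b Φ 𝓟) {K L : CochainComplex A ℤ}
    (hK : 𝓟 ((HomotopyCategory.quotient A _).obj K))
    (hL : 𝓟 ((HomotopyCategory.quotient A _).obj L)) (f : K ⟶ L) [QuasiIso f] :
    QuasiIso ((contraMap Φ).map f.op) := by
  -- Comparing the degreewise split sequences `K ⟶ cone (𝟙 K) ⟶ K⟦1⟧` and `L ⟶ cone f ⟶ K⟦1⟧` avoids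
  -- commuting `Φ` with cones and shifts: `Φ` makes both middle terms acyclic and is an isomorphism
  -- on the `K⟦1⟧` terms, which forces `Φ f` to be a quasi-isomorphism.
  let g : mappingCone.triangleRotateShortComplex (𝟙 K) ⟶
      mappingCone.triangleRotateShortComplex f :=
    { τ₁ := f
      τ₂ := mappingCone.map (𝟙 K) f (𝟙 K) f (by simp)
      τ₃ := 𝟙 _
      comm₁₂ := (mappingCone.triangleMap (𝟙 K) f (𝟙 K) f (by simp)).comm₂.symm
      comm₂₃ := by
        refine (mappingCone.triangleMap (𝟙 K) f (𝟙 K) f (by simp)).comm₃.symm.trans ?_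
        exact congrArg _ ((CategoryTheory.shiftFunctor _ (1 : ℤ)).map_id K) }
  have h₁ := contraShortComplex_shortExact Φ _
    (mappingCone.triangleRotateShortComplexSplitting (𝟙 K))
  have h₂ := contraShortComplex_shortExact Φ _
    (mappingCone.triangleRotateShortComplexSplitting f)
  refine HomologicalComplex.HomologySequence.quasiIso_τ₃ (contraShortComplexMap Φ g) h₂ h₁ ?_ ?_
  · have : IsIso (contraShortComplexMap Φ g).τ₁ :=
      inferInstanceAs (IsIso ((contraMap Φ).map (𝟙 _)))
    infer_instance
  · constructor
    intro n
    exact (quasiIsoAt_iff_exactAt _ n (h.acyclic_mappingCone hK hL f n)).2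
      (h.acyclic_mappingCone hK hK (𝟙 K) n)

end ContravariantExtension

/-! ### Strict pullbacks along epic quasi-isomorphisms, and stability of boundedness types. -/

section Pullback

variable {A : Type u₁} [Category.{v₁} A] [Abelian A]

lemma quasiIso_g_of_acyclic {S : ShortComplex (CochainComplex A ℤ)} (hS : S.ShortExact)
    (h : S.X₁.Acyclic) : QuasiIso S.g := by
  -- The sequence `0 ⟶ S.X₂ ⟶ S.X₂` maps to `S` by quasi-isomorphisms on the first two terms, hence
  -- also on the third, where the map is `S.g`.
  let T : ShortComplex (CochainComplex A ℤ) := 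
    ShortComplex.mk (0 : HomologicalComplex.zero ⟶ S.X₂) (𝟙 S.X₂) (by simp)
  have hT : T.ShortExact :=
    { exact := by
        rw [T.exact_iff_mono rfl]
        exact inferInstanceAs (Mono (𝟙 _))
      mono_f := ⟨fun _ _ _ => HomologicalComplex.isZero_zero.eq_of_tgt _ _⟩
      epi_g := inferInstanceAs (Epi (𝟙 _)) }
  let φ : T ⟶ S := { τ₁ := 0, τ₂ := 𝟙 _, τ₃ := S.g }
  refine HomologicalComplex.HomologySequence.quasiIso_τ₃ φ hT hS ⟨fun n => ?_⟩
    (inferInstanceAs (QuasiIso (𝟙 S.X₂)))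
  refine (quasiIsoAt_iff_exactAt' _ n (h n)).2 ?_
  rw [HomologicalComplex.exactAt_iff_isZero_homology]
  exact (HomologicalComplex.homologyFunctor A _ n).map_isZero HomologicalComplex.isZero_zero

lemma shortExact_kernel {K L : CochainComplex A ℤ} (f : K ⟶ L) [Epi f] :
    (ShortComplex.mk (kernel.ι f) f (kernel.condition f)).ShortExact where
  exact := ShortComplex.exact_kernel f
  mono_f := inferInstanceAs (Mono (kernel.ι f))
  epi_g := inferInstanceAs (Epi f)

/-- The projection has the same kernel as `f`, and that kernel is acyclic. -/
lemma quasiIso_pullback_snd {E F Z : CochainComplex A ℤ} (f : E ⟶ Z) (g : F ⟶ Z) [Epi f]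
    [QuasiIso f] : QuasiIso (pullback.snd f g) := by
  have h : (kernel f).Acyclic := (shortExact_kernel f).acyclic_X₁ inferInstance
  have := isIso_kernel_map_of_isPullback (IsPullback.of_hasPullback f g).flip
  refine quasiIso_g_of_acyclic (shortExact_kernel (pullback.snd f g)) (fun n => ?_)
  exact (quasiIsoAt_iff_exactAt' (kernel.map _ _ _ _
    (IsPullback.of_hasPullback f g).flip.w) n (h n)).1 inferInstance

lemma isZero_pullback_X {E F Z : CochainComplex A ℤ} (f : E ⟶ Z) (g : F ⟶ Z) (n : ℤ)
    (hE : IsZero (E.X n)) (hF : IsZero (F.X n)) : IsZero ((pullback f g).X n) := by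
  have h := ((IsPullback.of_hasPullback f g).map (HomologicalComplex.eval A _ n))
  rw [IsZero.iff_id_eq_zero]
  exact h.hom_ext (hE.eq_of_tgt _ _) (hF.eq_of_tgt _ _)

/-- No bound on `Z` is needed, in contrast to a homotopy pullback, whose terms involve those of `Z`.
-/
lemma BoundType.Holds.pullback {b : BoundType} {E F Z : CochainComplex A ℤ} (f : E ⟶ Z)
    (g : F ⟶ Z) (hE : b.Holds E) (hF : b.Holds F) : b.Holds (pullback f g) := by
  have hge : (∃ n : ℤ, E.IsStrictlyGE n) → (∃ n : ℤ, F.IsStrictlyGE n) →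
      ∃ n : ℤ, (Limits.pullback f g).IsStrictlyGE n := by
    rintro ⟨n, hn⟩ ⟨m, hm⟩
    refine ⟨min n m, (CochainComplex.isStrictlyGE_iff _ _).2 (fun i hi => ?_)⟩
    exact isZero_pullback_X f g i (E.isZero_of_isStrictlyGE n i (by omega))
      (F.isZero_of_isStrictlyGE m i (by omega))
  have hle : (∃ n : ℤ, E.IsStrictlyLE n) → (∃ n : ℤ, F.IsStrictlyLE n) →
      ∃ n : ℤ, (Limits.pullback f g).IsStrictlyLE n := by
    rintro ⟨n, hn⟩ ⟨m, hm⟩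
    refine ⟨max n m, (CochainComplex.isStrictlyLE_iff _ _).2 (fun i hi => ?_)⟩
    exact isZero_pullback_X f g i (E.isZero_of_isStrictlyLE n i (by omega))
      (F.isZero_of_isStrictlyLE m i (by omega))
  cases b with
  | unbounded => trivial
  | plus => exact hge hE hF
  | minus => exact hle hE hF
  | bounded => exact ⟨hge hE.1 hF.1, hle hE.2 hF.2⟩

lemma BoundType.Holds.truncLE {b : BoundType} {K : CochainComplex A ℤ} (hK : b.Holds K) (n : ℤ) :
    b.Holds (K.truncLE n) := by
  cases b with
  | unbounded => trivial
  | plus => obtain ⟨m, hm⟩ := hK; exact ⟨m, inferInstance⟩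
  | minus => exact ⟨n, inferInstance⟩
  | bounded => obtain ⟨⟨m, hm⟩, -⟩ := hK; exact ⟨⟨m, inferInstance⟩, ⟨n, inferInstance⟩⟩

lemma BoundType.holds_stalk (b : BoundType) (X : A) : b.Holds (stalk X) := by
  have hge : (stalk X).IsStrictlyGE 0 := (CochainComplex.isStrictlyGE_iff _ _).2 (fun i hi =>
    HomologicalComplex.isZero_single_obj_X _ _ _ _ hi.ne)
  have hle : (stalk X).IsStrictlyLE 0 := (CochainComplex.isStrictlyLE_iff _ _).2 (fun i hi =>
    HomologicalComplex.isZero_single_obj_X _ _ _ _ hi.ne')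
  cases b with
  | unbounded => trivial
  | plus => exact ⟨0, hge⟩
  | minus => exact ⟨0, hle⟩
  | bounded => exact ⟨⟨0, hge⟩, ⟨0, hle⟩⟩

end Pullback

/-! ### Stalk complexes and `H⁰` under left exact contravariant functors. -/

section Stalk

variable {A : Type u₁} [Category.{v₁} A] [Abelian A]
  {B : Type u₂} [Category.{v₂} B] [Abelian B]

lemma stalk_exactAt (X : A) (n : ℤ) (hn : n ≠ 0) : (stalk X).ExactAt n :=
  HomologicalComplex.exactAt_single_obj _ _ _ _ hn

lemma isZero_stalk_X (X : A) (n : ℤ) (hn : n ≠ 0) : IsZero ((stalk X).X n) :=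
  HomologicalComplex.isZero_single_obj_X _ _ _ _ hn

lemma quasiIsoAt_zero_iff_of_isStrictlyLE {E : CochainComplex A ℤ} [E.IsStrictlyLE 0] {X : A}
    (e : E ⟶ stalk X) :
    QuasiIsoAt e 0 ↔ (ShortComplex.mk (E.d (-1) 0) (e.f 0)
      (by rw [← e.comm]; simp)).Exact ∧ Epi (e.f 0) := by
  rw [quasiIsoAt_iff' e (-1) 0 1 (by simp) (by simp)]
  exact ShortComplex.quasiIso_iff_of_zeros' _
    ((E.isZero_of_isStrictlyLE 0 1 (by omega)).eq_of_tgt _ _) (HomologicalComplex.single_obj_d (ComplexShape.up ℤ) _ _ _ _)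
    (HomologicalComplex.single_obj_d (ComplexShape.up ℤ) _ _ _ _)

lemma quasiIsoAt_zero_iff_of_isStrictlyGE {T : CochainComplex A ℤ} [T.IsStrictlyGE 0] {Y : A}
    (m : stalk Y ⟶ T) :
    QuasiIsoAt m 0 ↔ (ShortComplex.mk (m.f 0) (T.d 0 1)
      (by rw [m.comm]; simp)).Exact ∧ Mono (m.f 0) := by
  rw [quasiIsoAt_iff' m (-1) 0 1 (by simp) (by simp)]
  exact ShortComplex.quasiIso_iff_of_zeros _ (HomologicalComplex.single_obj_d (ComplexShape.up ℤ) _ _ _ _)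
    (HomologicalComplex.single_obj_d (ComplexShape.up ℤ) _ _ _ _)
    ((T.isZero_of_isStrictlyGE 0 (-1) (by omega)).eq_of_src _ _)

lemma epi_of_isStrictlyLE {E : CochainComplex A ℤ} [E.IsStrictlyLE 0] {X : A}
    (e : E ⟶ stalk X) [QuasiIso e] : Epi e := by
  refine HomologicalComplex.epi_of_epi_f _ (fun n => ?_)
  by_cases hn : n = 0
  · subst hn
    exact ((quasiIsoAt_zero_iff_of_isStrictlyLE e).1 inferInstance).2
  · exact ⟨fun _ _ _ => (isZero_stalk_X X n hn).eq_of_src _ _⟩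

/-- A morphism from a complex in nonpositive degrees to a complex `T` in nonnegative degrees
factors through `H⁰(T)`. -/
lemma exists_lift_stalk {E T : CochainComplex A ℤ} [E.IsStrictlyLE 0] [T.IsStrictlyGE 0] {Y : A}
    (m : stalk Y ⟶ T) [QuasiIsoAt m 0] (g : E ⟶ T) : ∃ e : E ⟶ stalk Y, e ≫ m = g := by
  obtain ⟨h, hm⟩ := (quasiIsoAt_zero_iff_of_isStrictlyGE m).1 inferInstance
  obtain ⟨l, hl⟩ := h.lift' (g.f 0) (by
    rw [g.comm, (E.isZero_of_isStrictlyLE 0 1 (by omega)).eq_of_tgt (E.d 0 1) 0, zero_comp])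
  dsimp at l hl
  refine ⟨HomologicalComplex.mkHomToSingle
    (l ≫ (HomologicalComplex.singleObjXSelf (ComplexShape.up ℤ) 0 Y).hom) (fun i hi => ?_), ?_⟩
  · have : E.d i 0 ≫ l = 0 := by
      rw [← cancel_mono (m.f 0), Category.assoc, hl, ← g.comm,
        (T.isZero_of_isStrictlyGE 0 i (by simp at hi; omega)).eq_of_tgt (g.f i) 0,
        zero_comp, zero_comp]
    rw [← Category.assoc, this, zero_comp]
  · ext n
    rcases lt_trichotomy n 0 with hn | rfl | hn
    · exact (T.isZero_of_isStrictlyGE 0 n hn).eq_of_tgt _ _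
    · simp [HomologicalComplex.mkHomToSingle_f, hl]
    · exact (E.isZero_of_isStrictlyLE 0 n hn).eq_of_src _ _

/-- The stalk complex of `Φ X` is the image of the stalk complex of `X`. -/
noncomputable def stalkToContra (Φ : Aᵒᵖ ⥤ B) [Φ.Additive] (X : A) :
    stalk (Φ.obj (op X)) ⟶ contraObj Φ (stalk X) :=
  HomologicalComplex.mkHomFromSingle
    (Φ.map (HomologicalComplex.singleObjXSelf (ComplexShape.up ℤ) 0 X).hom.op) (fun k _ => by
      refine (congrArg _ (contraObj_d Φ _ _ _)).trans ?_
      rw [HomologicalComplex.single_obj_d, op_zero, Φ.map_zero]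
      exact comp_zero)

lemma isZero_contraObj_X (Φ : Aᵒᵖ ⥤ B) [Φ.Additive] (K : CochainComplex A ℤ) (n : ℤ)
    (h : IsZero (K.X (-n))) : IsZero ((contraObj Φ K).X n) :=
  Φ.map_isZero h.op

instance (Φ : Aᵒᵖ ⥤ B) [Φ.Additive] (X : A) : IsIso (stalkToContra Φ X) := by
  have (n : ℤ) : IsIso ((stalkToContra Φ X).f n) := by
    by_cases hn : n = 0
    · subst hn
      have h : (stalkToContra Φ X).f 0 =
        (HomologicalComplex.singleObjXSelf (ComplexShape.up ℤ) 0 (Φ.obj (op X))).hom ≫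
          Φ.map (HomologicalComplex.singleObjXSelf (ComplexShape.up ℤ) 0 X).hom.op :=
        HomologicalComplex.mkHomFromSingle_f _ _
      rw [h]
      exact IsIso.comp_isIso' inferInstance
        (inferInstanceAs (IsIso
          (Φ.map (HomologicalComplex.singleObjXSelf (ComplexShape.up ℤ) 0 X).hom.op)))
    · exact (isZero_stalk_X (Φ.obj (op X)) n hn).isIso
        (isZero_contraObj_X Φ _ n (isZero_stalk_X X _ (by omega))) _
  exact HomologicalComplex.Hom.isIso_of_components _

instance (Φ : Aᵒᵖ ⥤ B) [Φ.Additive] (K : CochainComplex A ℤ) [K.IsStrictlyLE 0] :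
    (contraObj Φ K).IsStrictlyGE 0 :=
  (CochainComplex.isStrictlyGE_iff _ _).2 (fun i hi =>
    isZero_contraObj_X Φ K i (K.isZero_of_isStrictlyLE 0 (-i) (by omega)))

lemma isIso_f_zero_of_quasiIsoAt {K L : CochainComplex A ℤ} (f : K ⟶ L)
    (hK : ∀ i j, K.d i j = 0) (hL : ∀ i j, L.d i j = 0) [hf : QuasiIsoAt f 0] :
    IsIso (f.f 0) := by
  rw [quasiIsoAt_iff' f (-1) 0 1 (by simp) (by simp)] at hf
  have h₁ := ((ShortComplex.quasiIso_iff_of_zeros _ (hK _ _) (hK _ _) (hL _ _)).1 hf).2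
  have h₂ := ((ShortComplex.quasiIso_iff_of_zeros' _ (hK _ _) (hL _ _) (hL _ _)).1 hf).2
  have h₁' : Mono (f.f 0) := h₁
  have h₂' : Epi (f.f 0) := h₂
  exact isIso_of_mono_of_epi _

/-- A left exact contravariant functor `Φ` satisfies `H⁰(Φ E) = Φ (H⁰ E)` for a complex `E` in
nonpositive degrees. -/
lemma quasiIsoAt_zero_contraMap (Φ : Aᵒᵖ ⥤ B) [Φ.Additive] [PreservesFiniteLimits Φ]
    {E : CochainComplex A ℤ} [E.IsStrictlyLE 0] {X : A} (e : E ⟶ stalk X) [QuasiIsoAt e 0] :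
    QuasiIsoAt ((contraMap Φ).map e.op) 0 := by
  obtain ⟨h, he⟩ := (quasiIsoAt_zero_iff_of_isStrictlyLE e).1 inferInstance
  rw [quasiIsoAt_iff' _ (-1) 0 1 (by simp) (by simp)]
  refine (ShortComplex.quasiIso_iff_of_zeros _ ?_ ?_ ?_).2 ⟨?_, ?_⟩
  · exact (isZero_contraObj_X Φ _ (-1) (isZero_stalk_X X _ (by omega))).eq_of_src _ _
  · exact (isZero_contraObj_X Φ _ 1 (isZero_stalk_X X _ (by omega))).eq_of_tgt _ _
  · exact ((contraObj Φ E).isZero_of_isStrictlyGE 0 (-1) (by omega)).eq_of_src _ _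
  · exact h.op.map_of_mono_of_preservesKernel Φ (inferInstanceAs (Mono (e.f 0).op)) inferInstance
  · exact inferInstanceAs (Mono (Φ.map (e.f 0).op))

end Stalk

/-! ### The derived functor at a stalk, computed by an arbitrary resolution. -/

section Resolution

variable {A : Type u₁} [Category.{v₁} A] [Abelian A]
  {B : Type u₂} [Category.{v₂} B] [Abelian B]

lemma quasiIsoAt_of_two_of_six {K L M N : CochainComplex A ℤ} (f : K ⟶ L) (g : L ⟶ M)
    (h : M ⟶ N) (n : ℤ) [hfg : QuasiIsoAt (f ≫ g) n] [hgh : QuasiIsoAt (g ≫ h) n] :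
    QuasiIsoAt g n := by
  rw [quasiIsoAt_iff_isIso_homologyMap, HomologicalComplex.homologyMap_comp] at hfg hgh
  rw [quasiIsoAt_iff_isIso_homologyMap]
  have := epi_of_epi (HomologicalComplex.homologyMap f n) (HomologicalComplex.homologyMap g n)
  have := mono_of_mono (HomologicalComplex.homologyMap g n) (HomologicalComplex.homologyMap h n)
  exact isIso_of_mono_of_epi _

lemma quasiIso_ιTruncLE_of_stalk {K : CochainComplex A ℤ} {X : A} (e : K ⟶ stalk X)
    [QuasiIso e] : QuasiIso (K.ιTruncLE 0) := by
  rw [CochainComplex.quasiIso_ιTruncLE_iff, CochainComplex.isLE_iff]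
  exact fun i hi => (quasiIsoAt_iff_exactAt' e i (stalk_exactAt X i (by omega))).1 inferInstance

variable {b : BoundType} {Φ : Aᵒᵖ ⥤ B} [Φ.Additive]
  {𝓟 : ObjectProperty (HomotopyCategory A (ComplexShape.up ℤ))} {X : A}

/-- The truncation `τ` of `P` need not lie in `𝓟`, so it is resolved by some `P'` in `𝓟`. In `Φ X ⟶
Φ P ⟶ Φ τ ⟶ Φ P'` the composite of the first two maps is an isomorphism on `H⁰` by left exactness,
and that of the last two is a quasi-isomorphism by adaptedness; two-out-of-six gives the middle map.
-/
lemma IsAdapted.quasiIsoAt_zero_ιTruncLE (h : IsAdapted b Φ 𝓟) [PreservesFiniteLimits Φ]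
    (R : PResolution 𝓟 (stalk X)) :
    QuasiIsoAt ((contraMap Φ).map (R.P.ιTruncLE 0).op) 0 := by
  have := quasiIso_ιTruncLE_of_stalk R.p
  obtain ⟨P', r, hP', hr⟩ := h.exists_quasiIso _ ((h.holds _ R.mem).truncLE 0)
  have := h.quasiIso_map hP' R.mem (r ≫ R.P.ιTruncLE 0)
  have := quasiIsoAt_zero_contraMap Φ (R.P.ιTruncLE 0 ≫ R.p)
  rw [contraMap_map_comp] at *
  exact quasiIsoAt_of_two_of_six ((contraMap Φ).map R.p.op) _
    ((contraMap Φ).map r.op) 0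

/-- The derived functor of a left exact functor `Φ` satisfies `H⁰(𝐑Φ X) = Φ X`. -/
lemma IsAdapted.quasiIsoAt_zero_p (h : IsAdapted b Φ 𝓟) [PreservesFiniteLimits Φ]
    (R : PResolution 𝓟 (stalk X)) : QuasiIsoAt ((contraMap Φ).map R.p.op) 0 := by
  have := quasiIso_ιTruncLE_of_stalk R.p
  have := h.quasiIsoAt_zero_ιTruncLE R
  have hc := quasiIsoAt_zero_contraMap Φ (R.P.ιTruncLE 0 ≫ R.p)
  rw [contraMap_map_comp] at hc
  exact quasiIsoAt_of_comp_right _ ((contraMap Φ).map (R.P.ιTruncLE 0).op) 0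

lemma PResolution.isZero_homology_derivedObj_iff {Y : CochainComplex A ℤ} (R : PResolution 𝓟 Y)
    [HasDerivedCategory.{w₂} B] (i : ℤ) :
    IsZero ((DerivedCategory.homologyFunctor B i).obj (R.derivedObj Φ)) ↔
      (contraObj Φ R.P).ExactAt i := by
  rw [HomologicalComplex.exactAt_iff_isZero_homology]
  exact ((DerivedCategory.homologyFunctorFactors B i).app _).isZero_iff

lemma contraObj_stalk_exactAt (Φ : Aᵒᵖ ⥤ B) [Φ.Additive] (X : A) (n : ℤ) (hn : n ≠ 0) :
    (contraObj Φ (stalk X)).ExactAt n :=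
  (quasiIsoAt_iff_exactAt (stalkToContra Φ X) n (stalk_exactAt _ n hn)).1 inferInstance

/-- The derived functor of `Φ` at a `Φ`-acyclic object `X` is `Φ X`. -/
lemma IsAdapted.quasiIso_p (h : IsAdapted b Φ 𝓟) [PreservesFiniteLimits Φ]
    (R : PResolution 𝓟 (stalk X)) (hR : ∀ n ≠ 0, (contraObj Φ R.P).ExactAt n) :
    QuasiIso ((contraMap Φ).map R.p.op) := by
  constructor
  intro n
  by_cases hn : n = 0
  · subst hn
    exact h.quasiIsoAt_zero_p R
  · exact (quasiIsoAt_iff_exactAt _ n (contraObj_stalk_exactAt Φ X n hn)).2 (hR n hn)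

end Resolution

/-! ### Naturality of the unit on complexes and comparison of the two derived units. -/

section Unit

variable {A : Type u₁} [Category.{v₁} A] [Abelian A]
  {B : Type u₂} [Category.{v₂} B] [Abelian B]
  {Φ : Aᵒᵖ ⥤ B} {Ψ : Bᵒᵖ ⥤ A} [Φ.Additive] [Ψ.Additive]

lemma XIsoOfEq_hom_comp_f {K L : CochainComplex A ℤ} (f : K ⟶ L) {n m : ℤ} (h : n = m) :
    (K.XIsoOfEq h).hom ≫ f.f m = f.f n ≫ (L.XIsoOfEq h).hom := by
  subst h
  simp

lemma complexUnit_naturality (adj : Φ.rightOp ⊣ Ψ) {K L : CochainComplex A ℤ} (f : K ⟶ L) :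
    complexUnit adj K ≫ (contraMap Ψ).map ((contraMap Φ).map f.op).op =
      f ≫ complexUnit adj L := by
  ext n
  have h : f.f (- -n) ≫ adj.unit.app (L.X (- -n)) = adj.unit.app (K.X (- -n)) ≫
      ((contraMap Ψ).map ((contraMap Φ).map f.op).op).f n := adj.unit.naturality (f.f (- -n))
  have h' : (K.XIsoOfEq (neg_neg n).symm).hom ≫ f.f (- -n) =
      f.f n ≫ (L.XIsoOfEq (neg_neg n).symm).hom :=
    XIsoOfEq_hom_comp_f f (neg_neg n).symm
  refine (Category.assoc _ _ _).trans ?_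
  refine (congrArg (fun t => (K.XIsoOfEq (neg_neg n).symm).hom ≫ t) h.symm).trans ?_
  refine (Category.assoc _ _ _).symm.trans ?_
  refine (congrArg (fun t => t ≫ adj.unit.app (L.X (- -n))) h').trans ?_
  exact Category.assoc _ _ _

lemma complexUnit_comp_map (adj : Φ.rightOp ⊣ Ψ) {K L : CochainComplex A ℤ}
    {M : CochainComplex B ℤ} (f : K ⟶ L) (g : M ⟶ contraObj Φ L) :
    complexUnit adj K ≫ (contraMap Ψ).map (g ≫ (contraMap Φ).map f.op).op =
      f ≫ complexUnit adj L ≫ (contraMap Ψ).map g.op := by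
  rw [contraMap_map_comp, ← Category.assoc, complexUnit_naturality, Category.assoc]

lemma contraObj_d_eq_zero (Φ : Aᵒᵖ ⥤ B) [Φ.Additive] (K : CochainComplex A ℤ)
    (hK : ∀ i j, K.d i j = 0) (i j : ℤ) : (contraObj Φ K).d i j = 0 := by
  rw [contraObj_d, hK, op_zero, Φ.map_zero]
  rfl

lemma isIso_unit_of_quasiIsoAt (adj : Φ.rightOp ⊣ Ψ) (X : A)
    [QuasiIsoAt (complexUnit adj (stalk X)) 0] : IsIso (adj.unit.app X) := by
  have hd : ∀ i j, (stalk X).d i j = 0 := fun i j => HomologicalComplex.single_obj_d (ComplexShape.up ℤ) _ _ _ _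
  have h : IsIso ((complexUnit adj (stalk X)).f 0) := isIso_f_zero_of_quasiIsoAt _ hd
    (contraObj_d_eq_zero Ψ _ (contraObj_d_eq_zero Φ _ hd))
  have h' : IsIso (((stalk X).XIsoOfEq (neg_neg 0).symm).hom ≫
    adj.unit.app ((stalk X).X (- -0))) := h
  have h'' : IsIso (adj.unit.app ((stalk X).X (- -0))) := IsIso.of_isIso_comp_left
    ((stalk X).XIsoOfEq (neg_neg 0).symm).hom _
  exact (NatTrans.isIso_app_iff_of_iso adj.unit
    (HomologicalComplex.singleObjXSelf (ComplexShape.up ℤ) 0 X)).1 h''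

variable {b c : BoundType} {𝓟 : ObjectProperty (HomotopyCategory A (ComplexShape.up ℤ))}
  {𝓠 : ObjectProperty (HomotopyCategory B (ComplexShape.up ℤ))} {X : A}

/-- If `X` is `Φ`-acyclic and the derived unit at `X` is an isomorphism, then so is the
derived unit computed by a resolution of `Φ X`. -/
lemma quasiIso_stalk_unit (adj : Φ.rightOp ⊣ Ψ) (h𝓟 : IsAdapted b Φ 𝓟) (h𝓠 : IsAdapted c Ψ 𝓠)
    [PreservesFiniteLimits Φ]
    (R : PResolution 𝓟 (stalk X)) (hR : ∀ n ≠ 0, (contraObj Φ R.P).ExactAt n)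
    (S : PResolution 𝓠 (contraObj Φ R.P))
    (hS : QuasiIso (complexUnit adj R.P ≫ (contraMap Ψ).map S.p.op))
    (S' : PResolution 𝓠 (stalk (Φ.obj (op X)))) :
    QuasiIso (complexUnit adj (stalk X) ≫
      (contraMap Ψ).map (S'.p ≫ stalkToContra Φ X).op) := by
  have hι := quasiIso_ιTruncLE_of_stalk R.p
  have hΦι := h𝓟.quasiIsoAt_zero_ιTruncLE R
  have hΦp := h𝓟.quasiIso_p R hR
  have hm : QuasiIsoAt (stalkToContra Φ X ≫ (contraMap Φ).map R.p.op ≫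
      (contraMap Φ).map (R.P.ιTruncLE 0).op) 0 := inferInstance
  -- The truncation of `Q` lies in degrees `≤ 0` and `Φ` of the truncation of `P` in degrees `≥ 0`,
  -- so the map between them factors strictly, not just up to homotopy, through the stalk of `Φ X`.
  obtain ⟨e, he⟩ := exists_lift_stalk (stalkToContra Φ X ≫ (contraMap Φ).map R.p.op ≫
    (contraMap Φ).map (R.P.ιTruncLE 0).op) ((S.P.ιTruncLE 0 ≫ S.p) ≫
    (contraMap Φ).map (R.P.ιTruncLE 0).op)
  have hQ (n : ℤ) (hn : n ≠ 0) : S.P.ExactAt n :=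
    (quasiIsoAt_iff_exactAt' S.p n (hR n hn)).1 inferInstance
  have hιQ : QuasiIso (S.P.ιTruncLE 0) := by
    rw [CochainComplex.quasiIso_ιTruncLE_iff, CochainComplex.isLE_iff]
    exact fun i hi => hQ i (by omega)
  have he' : QuasiIso e := by
    constructor
    intro n
    by_cases hn : n = 0
    · subst hn
      rw [← quasiIsoAt_iff_comp_right _ _ _ (hφ' := hm), he]
      infer_instance
    · refine (quasiIsoAt_iff_exactAt' _ n (stalk_exactAt _ n hn)).2 ?_
      exact (quasiIsoAt_iff_exactAt' (S.P.ιTruncLE 0) n (hQ n hn)).1 inferInstance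
  have := epi_of_isStrictlyLE e
  have hsnd := quasiIso_pullback_snd e S'.p
  have hfst : QuasiIso (pullback.fst e S'.p) := by
    have : QuasiIso (pullback.fst e S'.p ≫ e) := by
      rw [pullback.condition]
      infer_instance
    exact quasiIso_of_comp_right _ e
  -- A common refinement in `𝓠` of the two resolutions; `Ψ` inverts neither truncation nor pullback
  -- directly, only the maps `u` and `v` between objects of `𝓠`.
  obtain ⟨Q, r, hQ, hr⟩ := h𝓠.exists_quasiIso (pullback e S'.p)
    (BoundType.Holds.pullback _ _ ((h𝓠.holds _ S.mem).truncLE 0) (h𝓠.holds _ S'.mem))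
  let u : Q ⟶ S.P := r ≫ pullback.fst e S'.p ≫ S.P.ιTruncLE 0
  let v : Q ⟶ S'.P := r ≫ pullback.snd e S'.p
  have hu : QuasiIso ((contraMap Ψ).map u.op) := by
    have : QuasiIso u := inferInstance
    exact h𝓠.quasiIso_map hQ S.mem u
  have hv : QuasiIso ((contraMap Ψ).map v.op) := by
    have : QuasiIso v := inferInstance
    exact h𝓠.quasiIso_map hQ S'.mem v
  have huv : (u ≫ S.p) ≫ (contraMap Φ).map (R.P.ιTruncLE 0).op =
      (v ≫ S'.p ≫ stalkToContra Φ X) ≫ (contraMap Φ).map (R.P.ιTruncLE 0 ≫ R.p).op := by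
    have h₁ : (u ≫ S.p) ≫ (contraMap Φ).map (R.P.ιTruncLE 0).op =
        r ≫ pullback.fst e S'.p ≫ ((S.P.ιTruncLE 0 ≫ S.p) ≫
          (contraMap Φ).map (R.P.ιTruncLE 0).op) := by
      simp only [u, Category.assoc]
    rw [h₁, ← he, pullback.condition_assoc, contraMap_map_comp]
    simp only [v, Category.assoc]
  have key : R.P.ιTruncLE 0 ≫ (complexUnit adj R.P ≫ (contraMap Ψ).map S.p.op) ≫
      (contraMap Ψ).map u.op = (R.P.ιTruncLE 0 ≫ R.p) ≫ (complexUnit adj (stalk X) ≫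
        (contraMap Ψ).map (S'.p ≫ stalkToContra Φ X).op) ≫ (contraMap Ψ).map v.op := by
    -- By naturality of the unit, both sides equal the unit at the truncation of `P` followed by `Ψ`
    -- of the common map in `huv`.
    have h₁ := complexUnit_comp_map adj (R.P.ιTruncLE 0) (u ≫ S.p)
    rw [huv, complexUnit_comp_map, contraMap_map_comp Ψ v, contraMap_map_comp Ψ u] at h₁
    simpa only [Category.assoc] using h₁.symm
  have hl : QuasiIso ((R.P.ιTruncLE 0 ≫ R.p) ≫ (complexUnit adj (stalk X) ≫
      (contraMap Ψ).map (S'.p ≫ stalkToContra Φ X).op) ≫ (contraMap Ψ).map v.op) := by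
    rw [← key]
    infer_instance
  rw [quasiIso_iff_comp_left, quasiIso_iff_comp_right] at hl
  exact hl

end Unit

theorem mainTheorem8 {A : Type u₁} [Category.{v₁} A] [Abelian A] [HasDerivedCategory.{w₁} A]
    {B : Type u₂} [Category.{v₂} B] [Abelian B] [HasDerivedCategory.{w₂} B]
    (Φ : Aᵒᵖ ⥤ B) (Ψ : Bᵒᵖ ⥤ A) [Φ.Additive] [Ψ.Additive] (adj : Φ.rightOp ⊣ Ψ)
    (b c : BoundType)
    (𝓟 : ObjectProperty (HomotopyCategory A (ComplexShape.up ℤ)))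
    (𝓠 : ObjectProperty (HomotopyCategory B (ComplexShape.up ℤ)))
    (h𝓟 : IsAdapted b Φ 𝓟) (h𝓠 : IsAdapted c Ψ 𝓠)
    (X : A) (hX : IsContraAcyclic 𝓟 Φ X) (hX' : IsDReflexive adj 𝓟 𝓠 X) :
    IsInG adj 𝓟 𝓠 X := by
  -- Left exactness of `Φ` is right exactness of the left adjoint `Φ.rightOp`.
  have := adj.leftAdjoint_preservesColimits
  have := adj.rightAdjoint_preservesLimits
  have : PreservesFiniteLimits Φ := preservesFiniteLimits_of_rightOp Φ
  have : PreservesFiniteLimits Ψ := inferInstance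
  obtain ⟨R, S, h⟩ := hX'
  have hR (n : ℤ) (hn : n ≠ 0) : (contraObj Φ R.P).ExactAt n :=
    (R.isZero_homology_derivedObj_iff n).1 (hX R n hn)
  have hS : QuasiIso (complexUnit adj R.P ≫ (contraMap Ψ).map S.p.op) := by
    rw [← DerivedCategory.isIso_Q_map_iff_quasiIso]
    have h' : IsIso (inv (DerivedCategory.Q.map R.p) ≫
      DerivedCategory.Q.map (complexUnit adj R.P ≫ (contraMap Ψ).map S.p.op)) := h
    exact IsIso.of_isIso_comp_left (inv (DerivedCategory.Q.map R.p)) _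
  have hunit := quasiIso_stalk_unit adj h𝓟 h𝓠 R hR S hS
  refine ⟨hX, fun S' i hi => ?_, ?_⟩
  · have := hunit S'
    exact (S'.isZero_homology_derivedObj_iff i).2
      ((quasiIsoAt_iff_exactAt (complexUnit adj (stalk X) ≫
        (contraMap Ψ).map (S'.p ≫ stalkToContra Φ X).op) i (stalk_exactAt X i hi)).1 inferInstance)
  · obtain ⟨Q, p, hQ, hp⟩ := h𝓠.exists_quasiIso _ (c.holds_stalk (Φ.obj (op X)))
    let S' : PResolution 𝓠 (stalk (Φ.obj (op X))) := ⟨Q, hQ, p, hp⟩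
    have h₁ := hunit S'
    have h₂ := h𝓠.quasiIsoAt_zero_p S'
    have : IsIso ((contraMap Ψ).map (stalkToContra Φ X).op) := inferInstance
    -- On `H⁰` this is the identification `Ψ(Φ X) = H⁰(ΨQ')`; cancelling it from the derived unit
    -- leaves `η_X`.
    have h₃ : QuasiIsoAt ((contraMap Ψ).map (S'.p ≫ stalkToContra Φ X).op) 0 := by
      rw [contraMap_map_comp]
      infer_instance
    have := quasiIsoAt_of_comp_right (complexUnit adj (stalk X))
      ((contraMap Ψ).map (S'.p ≫ stalkToContra Φ X).op) 0
    exact isIso_unit_of_quasiIsoAt adj X
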